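/- All graphs are finite and simple. A set $S$ of vertices of a graph $G$ is a zero forcing set if, starting with exactly the vertices of $S$ active and repeatedly applying the rule ``if all neighbors of an active vertex $u$ except one neighbor $v$ are active, then $v$ becomes active'', all vertices of $G$ become active. A graph $G$ is an iso-unique zero forcing graph if for any two zero forcing sets $A,B$ of $G$ of minimum cardinality there is an automorphism $\varphi$ of $G$ with $\varphi(A)=B$. A path cover of a tree is a set of pairwise vertex-disjoint induced paths (one-vertex paths are allowed) that cover all its vertices; it is minimum if no other path cover has fewer paths. A leaf is a vertex of degree $1$. Let $T$ be a tree that is an iso-unique zero forcing graph, and let $T'$ be a graph obtained from $T$ by removing, for every vertex $v$ of $T$ that is adjacent to more than two leaves of $T$, all but two (arbitrarily chosen) of the leaves adjacent to $v$. Then $T'$ is a tree and it has exactly one minimum path cover. -/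

import Mathlib

namespace IsoUniqueZF

universe u

variable {V : Type u}

/-! ### Zero forcing -/

/-- `Active G S v`: starting from the active set `S`, the vertex `v` eventually becomes active
under the rule "an active vertex `a`, all of whose neighbours other than `b` are active,
forces its neighbour `b` to become active". -/
inductive Active (G : SimpleGraph V) (S : Set V) : V → Prop
  | init (v : V) (hv : v ∈ S) : Active G S v
  | force (a b : V) (ha : Active G S a) (hab : G.Adj a b)
      (hrest : ∀ w, G.Adj a w → w ≠ b → Active G S w) : Active G S b

/-- `S` is a zero forcing set of `G`. -/
def IsZeroForcingSet (G : SimpleGraph V) (S : Set V) : Prop :=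
  ∀ v, Active G S v

/-- `S` is a zero forcing set of `G` of minimum cardinality. -/
def IsMinZeroForcingSet (G : SimpleGraph V) (S : Set V) : Prop :=
  IsZeroForcingSet G S ∧ ∀ S' : Set V, IsZeroForcingSet G S' → S.encard ≤ S'.encard

/-- Any two minimum zero forcing sets are exchanged by an automorphism of `G`. -/
def IsIsoUniqueZeroForcing (G : SimpleGraph V) : Prop :=
  ∀ A B : Set V, IsMinZeroForcingSet G A → IsMinZeroForcingSet G B →
    ∃ φ : G ≃g G, φ '' A = B

/-! ### Path covers -/

/-- The subgraph `H` of `G` is an induced path (possibly with just one vertex). -/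
def IsInducedPath (G : SimpleGraph V) (H : G.Subgraph) : Prop :=
  H.IsInduced ∧ ∃ (a b : V) (p : G.Walk a b), p.IsPath ∧ p.toSubgraph = H

/-- A set of vertex-disjoint induced paths of `G` that cover all vertices. -/
def IsPathCover (G : SimpleGraph V) (P : Set G.Subgraph) : Prop :=
  (∀ H ∈ P, IsInducedPath G H) ∧
  (∀ H ∈ P, ∀ K ∈ P, H ≠ K → Disjoint H.verts K.verts) ∧
  ∀ v, ∃ H ∈ P, v ∈ H.verts

/-- A path cover with the least possible number of paths. -/
def IsMinPathCover (G : SimpleGraph V) (P : Set G.Subgraph) : Prop :=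
  IsPathCover G P ∧ ∀ P' : Set G.Subgraph, IsPathCover G P' → P.encard ≤ P'.encard

/-! ### Removing superfluous leaves -/

/-- The set of leaves (vertices of degree one) of `G` that are adjacent to `v`. -/
def leavesAt (G : SimpleGraph V) (v : V) : Set V :=
  {x | G.Adj v x ∧ (G.neighborSet x).encard = 1}

/-- `W` is what remains of the vertex set of `G` when, for every vertex `v` adjacent to more than
two leaves, all but two of the leaves adjacent to `v` (and no other vertices) are removed. -/
def IsLeafReduction (G : SimpleGraph V) (W : Set V) : Prop :=
  (∀ x, x ∉ W → ∃ v, 2 < (leavesAt G v).encard ∧ x ∈ leavesAt G v) ∧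
  ∀ v, 2 < (leavesAt G v).encard → (leavesAt G v ∩ W).encard = 2

end IsoUniqueZF

namespace IsoUniqueZF

universe u

variable {V : Type u}

open SimpleGraph

/-! A minimum path cover of a tree amounts to a subgraph of maximum degree at most two with as many
edges as possible, because the number of paths plus the number of edges is the number of vertices
(`isMinPathCover_iff`). Choosing one end of each path yields a minimum zero forcing set
(`IsMaxLinear.isMinZeroForcingSet_range`). Two choices that differ on a single path are related by
an automorphism, and automorphisms preserve the distance sum `distSum`; hence both ends of each path
have the same distance sum (`distSum_eq_of_reachable`).

The distance sum is strictly convex along paths of the tree (`two_mul_distSum_lt`). If an end had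
degree at least two in the tree, exchanging one edge would produce another optimal forest containing
a path whose ends have different distance sums. So all ends have tree degree at most one
(`ncard_neighborSet_le_one_of_end`). An optimal forest of the reduced tree is also optimal in `T`,
and the limit of two leaves per crowded vertex excludes isolated leaves, so its degree at each
retained vertex is the minimum of two and the tree degree (`ncard_neighborSet_eq_min`). Subgraphs of
a tree with equal degrees coincide (`eq_of_ncard_neighborSet_eq`).

Convexity also gives `not_of_forall_exists_continuation`, which stands in for following a path until
it stops. -/

/-! ### Sums of distances in a tree -/

/-- In an acyclic graph a vertex has at most one neighbour that is closer to a given vertex. -/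
theorem eq_of_dist_eq_dist_add_one {G : SimpleGraph V} (hG : G.IsAcyclic) {a b c x : V}
    (hb : G.Reachable b x) (hba : G.Adj b a) (hbc : G.Adj b c)
    (ha : G.dist b x = G.dist a x + 1) (hc : G.dist b x = G.dist c x + 1) : a = c := by
  obtain ⟨p, hp⟩ := (hba.symm.reachable.trans hb).exists_walk_length_eq_dist
  obtain ⟨q, hq⟩ := (hbc.symm.reachable.trans hb).exists_walk_length_eq_dist
  have hp' : (Walk.cons hba p).IsPath :=
    Walk.isPath_of_length_eq_dist _ (by rw [Walk.length_cons, hp, ha])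
  have hq' : (Walk.cons hbc q).IsPath :=
    Walk.isPath_of_length_eq_dist _ (by rw [Walk.length_cons, hq, hc])
  have := (hG.subsingleton_path b x).elim ⟨_, hp'⟩ ⟨_, hq'⟩
  have h2 := congrArg (fun r : G.Path b x => r.1.snd) this
  simpa using h2

/-- The sum of the distances from a vertex to all vertices. -/
noncomputable def distSum [Fintype V] (G : SimpleGraph V) (v : V) : ℕ := ∑ x, G.dist v x

/-- Strict convexity: at most one neighbour of `b` is nearer to a given `x`, so the inequality holds
termwise; the term `x = b` makes it strict. -/
theorem two_mul_distSum_lt [Fintype V] {T : SimpleGraph V} (hT : T.IsTree) {a b c : V}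
    (hba : T.Adj b a) (hbc : T.Adj b c) (hac : a ≠ c) :
    2 * distSum T b < distSum T a + distSum T c := by
  have key : ∀ x, T.dist b x + T.dist b x ≤ T.dist a x + T.dist c x := by
    intro x
    have h1 := hT.dist_eq_dist_add_one_of_adj x hba
    have h2 := hT.dist_eq_dist_add_one_of_adj x hbc
    simp only [T.dist_comm (u := x)] at h1 h2
    by_contra hlt
    exact hac (eq_of_dist_eq_dist_add_one hT.isAcyclic (hT.connected b x) hba hbc
      (by omega) (by omega))
  unfold distSum
  rw [two_mul, ← Finset.sum_add_distrib, ← Finset.sum_add_distrib]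
  refine Finset.sum_lt_sum (fun x _ => key x) ⟨b, Finset.mem_univ _, ?_⟩
  rw [T.dist_self, dist_eq_one_iff_adj.2 hba.symm, dist_eq_one_iff_adj.2 hbc.symm]
  norm_num

theorem dist_map_iso_le {V' : Type*} {G : SimpleGraph V} {G' : SimpleGraph V'} (φ : G ≃g G')
    (hG : G.Connected) (u v : V) : G'.dist (φ u) (φ v) ≤ G.dist u v := by
  obtain ⟨p, hp⟩ := hG.exists_walk_length_eq_dist u v
  rw [← hp, ← Walk.length_map φ.toHom p]
  exact dist_le _

theorem distSum_map_iso [Fintype V] {T : SimpleGraph V} (hT : T.Connected) (φ : T ≃g T) (v : V) :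
    distSum T (φ v) = distSum T v := by
  unfold distSum
  rw [← φ.toEquiv.sum_comp]
  refine Finset.sum_congr rfl fun x _ => le_antisymm (dist_map_iso_le φ hT v x) ?_
  simpa using dist_map_iso_le φ.symm hT (φ v) (φ x)

/-- In a finite tree there is no nonempty set of darts in which every dart has a
non-backtracking continuation. -/
theorem not_of_forall_exists_continuation [Finite V] {T : SimpleGraph V} (hT : T.IsTree)
    (Φ : V → V → Prop) (hadj : ∀ x y, Φ x y → T.Adj x y)
    (hcont : ∀ x y, Φ x y → ∃ z, z ≠ x ∧ Φ y z) (x y : V) : ¬ Φ x y := by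
  cases nonempty_fintype V
  intro h
  -- By convexity the increase of `distSum` grows strictly under continuation, so a dart of maximal
  -- increase has none.
  obtain ⟨⟨a, b⟩, hab, hmax⟩ := (Set.toFinite {d : V × V | Φ d.1 d.2}).exists_maximalFor
    (fun d => (distSum T d.2 : ℤ) - distSum T d.1) _ ⟨(x, y), h⟩
  obtain ⟨c, hca, hbc⟩ := hcont a b hab
  have h1 := two_mul_distSum_lt hT (hadj _ _ hab).symm (hadj _ _ hbc) hca.symm
  have h2 := hmax (j := (b, c)) hbc (by dsimp only at *; omega)
  dsimp only at *
  omega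

/-! ### Spanning subgraphs of maximum degree two -/

/-- All vertex degrees are at most two. -/
def IsLinear (F : SimpleGraph V) : Prop := ∀ v, (F.neighborSet v).ncard ≤ 2

/-- `F` has the most edges among the subgraphs of `T` of maximum degree at most two. -/
def IsMaxLinear (T F : SimpleGraph V) : Prop :=
  (F ≤ T ∧ IsLinear F) ∧
    ∀ F' : SimpleGraph V, F' ≤ T → IsLinear F' → F'.edgeSet.ncard ≤ F.edgeSet.ncard

theorem exists_isMaxLinear [Finite V] (T : SimpleGraph V) : ∃ F, IsMaxLinear T F := by
  obtain ⟨F, hF, hmax⟩ := (Set.toFinite {F : SimpleGraph V | F ≤ T ∧ IsLinear F}).exists_maximalFor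
    (fun F => F.edgeSet.ncard) _ ⟨⊥, bot_le, fun v => by simp [SimpleGraph.neighborSet]⟩
  refine ⟨F, hF, fun F' h1 h2 => ?_⟩
  rcases le_total (F'.edgeSet.ncard) (F.edgeSet.ncard) with h | h
  · exact h
  · exact hmax (j := F') ⟨h1, h2⟩ h

theorem adj_of_reachable_of_le {T F : SimpleGraph V} (hT : T.IsAcyclic) (hF : F ≤ T) {u w : V}
    (h : T.Adj u w) (hr : F.Reachable u w) : F.Adj u w := by
  obtain ⟨p, hp⟩ := hr.exists_isPath
  have h1 : (p.mapLe hF).IsPath := by simpa using hp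
  have := (hT.subsingleton_path u w).elim ⟨_, h1⟩ ⟨_, h.isPath_toWalk⟩
  have h2 : (p.mapLe hF).length = 1 := by
    rw [congrArg (fun r : T.Path u w => r.1.length) this]; simp
  rw [Walk.mapLe, Walk.length_map] at h2
  exact Walk.adj_of_length_eq_one h2

theorem edgeSet_ncard_sup_edge [Finite V] {F : SimpleGraph V} {u w : V} (h : ¬ F.Adj u w)
    (huw : u ≠ w) : (F ⊔ edge u w).edgeSet.ncard = F.edgeSet.ncard + 1 := by
  rw [edgeSet_sup, edgeSet_edge_of_ne huw, Set.union_singleton,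
    Set.ncard_insert_of_notMem (by simpa using h)]

theorem edgeSet_ncard_sdiff_edge [Finite V] {F : SimpleGraph V} {u w : V} (h : F.Adj u w) :
    (F \ edge u w).edgeSet.ncard + 1 = F.edgeSet.ncard := by
  rw [edgeSet_sdiff, edgeSet_edge_of_ne h.ne, Set.ncard_sdiff_singleton_add_one (by simpa using h)]

theorem ncard_neighborSet_sup_edge_le [Finite V] (F : SimpleGraph V) (u w : V) :
    ((F ⊔ edge u w).neighborSet u).ncard ≤ (F.neighborSet u).ncard + 1 := by
  refine le_trans (Set.ncard_le_ncard (t := insert w (F.neighborSet u)) ?_) (Set.ncard_insert_le _ _)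
  intro x hx
  simp only [mem_neighborSet, sup_adj, edge_adj] at hx
  simp only [Set.mem_insert_iff, mem_neighborSet]
  tauto

theorem neighborSet_sup_edge_of_ne {F : SimpleGraph V} {u w v : V} (hu : v ≠ u) (hw : v ≠ w) :
    (F ⊔ edge u w).neighborSet v = F.neighborSet v := by
  ext x
  simp only [mem_neighborSet, sup_adj, edge_adj]
  tauto

theorem isLinear_mono [Finite V] {F F' : SimpleGraph V} (h : F' ≤ F) (hF : IsLinear F) :
    IsLinear F' := fun v =>
  (Set.ncard_le_ncard fun _ hx => h hx).trans (hF v)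

theorem isLinear_sup_edge [Finite V] {F : SimpleGraph V} (hF : IsLinear F) {u w : V}
    (hu : (F.neighborSet u).ncard ≤ 1) (hw : (F.neighborSet w).ncard ≤ 1) :
    IsLinear (F ⊔ edge u w) := by
  intro v
  by_cases h1 : v = u
  · subst h1
    exact (ncard_neighborSet_sup_edge_le _ _ _).trans (by omega)
  by_cases h2 : v = w
  · subst h2
    rw [edge_comm]
    exact (ncard_neighborSet_sup_edge_le _ _ _).trans (by omega)
  rw [neighborSet_sup_edge_of_ne h1 h2]
  exact hF v

theorem ncard_neighborSet_sdiff_edge_le [Finite V] {F : SimpleGraph V} (hF : IsLinear F) {w x : V}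
    (h : F.Adj w x) : ((F \ edge w x).neighborSet w).ncard ≤ 1 := by
  have h1 : (F \ edge w x).neighborSet w ⊆ F.neighborSet w \ {x} := by
    intro y hy
    simp only [mem_neighborSet, sdiff_adj, edge_adj] at hy
    refine ⟨hy.1, ?_⟩
    rintro rfl
    exact hy.2 ⟨Or.inl ⟨trivial, rfl⟩, hy.1.ne⟩
  have h2 := Set.ncard_le_ncard h1
  have h3 := Set.ncard_sdiff_singleton_add_one (s := F.neighborSet w) (a := x) h
  have := hF w
  omega

/-- An end of a path of a maximum linear subgraph is only adjacent to inner vertices of other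
paths. -/
theorem IsMaxLinear.ncard_eq_two [Finite V] {T F : SimpleGraph V} (hF : IsMaxLinear T F) {u w : V}
    (huw : T.Adj u w) (h : ¬ F.Adj u w) (hu : (F.neighborSet u).ncard ≤ 1) :
    (F.neighborSet w).ncard = 2 := by
  by_contra hne
  have h1 := hF.1.2 w
  have := hF.2 (F ⊔ edge u w) (sup_le hF.1.1 (by rwa [edge_le_iff, or_iff_right huw.ne]))
    (isLinear_sup_edge hF.1.2 hu (by omega))
  rw [edgeSet_ncard_sup_edge h huw.ne] at this
  omega

/-- The exchange move: one edge is lost and one gained, so optimality persists, while `x` becomes an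
end. -/
theorem IsMaxLinear.swap [Finite V] {T F : SimpleGraph V} (hF : IsMaxLinear T F) {u w x : V}
    (huw : T.Adj u w) (h : ¬ F.Adj u w) (hu : (F.neighborSet u).ncard ≤ 1) (hwx : F.Adj w x) :
    IsMaxLinear T (F \ edge w x ⊔ edge u w) ∧
      ((F \ edge w x ⊔ edge u w).neighborSet x).ncard ≤ 1 := by
  have hxu : x ≠ u := by rintro rfl; exact h hwx.symm
  refine ⟨⟨⟨sup_le (sdiff_le.trans hF.1.1) (by rwa [edge_le_iff, or_iff_right huw.ne]), ?_⟩, ?_⟩, ?_⟩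
  · refine isLinear_sup_edge (isLinear_mono sdiff_le hF.1.2) ?_ ?_
    · exact (Set.ncard_le_ncard fun _ hx => sdiff_le (a := F) hx).trans hu
    · exact ncard_neighborSet_sdiff_edge_le hF.1.2 hwx
  · intro F' h1 h2
    rw [edgeSet_ncard_sup_edge (fun h' => h (sdiff_le (a := F) h')) huw.ne, edgeSet_ncard_sdiff_edge hwx]
    exact hF.2 F' h1 h2
  · rw [neighborSet_sup_edge_of_ne hxu hwx.ne', edge_comm]
    exact ncard_neighborSet_sdiff_edge_le hF.1.2 hwx.symm

/-- Subgraphs of a tree with equal vertex degrees are equal. -/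
theorem eq_of_ncard_neighborSet_eq [Finite V] {T F₁ F₂ : SimpleGraph V} (hT : T.IsTree)
    (h₁ : F₁ ≤ T) (h₂ : F₂ ≤ T)
    (h : ∀ v, (F₁.neighborSet v).ncard = (F₂.neighborSet v).ncard) : F₁ = F₂ := by
  have key : ∀ {F F' : SimpleGraph V}, (∀ v, (F.neighborSet v).ncard = (F'.neighborSet v).ncard) →
      ∀ {x y}, F.Adj x y → ¬ F'.Adj x y → ∃ z, z ≠ x ∧ F'.Adj y z ∧ ¬ F.Adj y z := by
    intro F F' hd x y hxy hxy'
    by_contra! hcon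
    have hsub : F'.neighborSet y ⊆ F.neighborSet y := fun z hz =>
      hcon z (by rintro rfl; exact hxy' (hz : F'.Adj y z).symm) hz
    have := Set.eq_of_subset_of_ncard_le hsub (hd y).le
    exact hxy' (this ▸ hxy.symm : x ∈ F'.neighborSet y).symm
  -- Equal degrees at `y` force an edge of one graph only to be followed by an edge of the other
  -- graph only, so a difference would start an endless alternating walk.
  have hno := not_of_forall_exists_continuation hT
    (fun x y => (F₁.Adj x y ∧ ¬ F₂.Adj x y) ∨ (F₂.Adj x y ∧ ¬ F₁.Adj x y))
    (by rintro x y (h | h); exacts [h₁ h.1, h₂ h.1])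
    (by
      rintro x y (hxy | hxy)
      · obtain ⟨z, hz, h3⟩ := key h hxy.1 hxy.2
        exact ⟨z, hz, Or.inr h3⟩
      · obtain ⟨z, hz, h3⟩ := key (fun v => (h v).symm) hxy.1 hxy.2
        exact ⟨z, hz, Or.inl h3⟩)
  ext x y
  have := hno x y
  tauto

/-! ### Ends of components -/

/-- A vertex of a component that is farthest from a given vertex has degree at most one. -/
theorem exists_end [Finite V] {F : SimpleGraph V} (hF : F.IsAcyclic) (u : V) :
    ∃ r, F.Reachable u r ∧ (F.neighborSet r).ncard ≤ 1 ∧ (r = u → F.neighborSet u = ∅) := by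
  obtain ⟨r, hr, hmax⟩ := (Set.toFinite {r | F.Reachable u r}).exists_maximalFor
    (fun r => F.dist u r) _ ⟨u, Reachable.refl u⟩
  have hle : ∀ z, F.Reachable u z → F.dist u z ≤ F.dist u r := fun z hz =>
    (le_total _ _).elim id (hmax (j := z) hz)
  refine ⟨r, hr, ?_, ?_⟩
  · rw [Set.ncard_le_one]
    have : ∀ z, F.Adj r z → F.dist r u = F.dist z u + 1 := by
      intro z hz
      have h1 := hF.dist_eq_dist_add_one_of_adj_of_reachable u hz hr
      have h2 := hle z (hr.trans hz.reachable)
      rw [F.dist_comm (u := r), F.dist_comm (u := z)]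
      omega
    exact fun a ha b hb => eq_of_dist_eq_dist_add_one hF hr.symm ha hb (this a ha) (this b hb)
  · rintro rfl
    ext z
    simp only [mem_neighborSet, Set.mem_empty_iff_false, iff_false]
    intro hz
    have h2 := hle z hz.reachable
    rw [dist_eq_one_iff_adj.2 hz, F.dist_self] at h2
    omega

/-- Starting at a dart along which the distance sum does not decrease one reaches an end. -/
theorem exists_end_of_distSum_le [Fintype V] {T F : SimpleGraph V} (hT : T.IsTree) (hF : F ≤ T)
    {a b : V} (hab : F.Adj a b) (hs : distSum T a ≤ distSum T b) :
    ∃ r, F.Reachable b r ∧ (F.neighborSet r).ncard ≤ 1 ∧ distSum T b ≤ distSum T r := by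
  by_contra! hcon
  -- Once `distSum` does not decrease, convexity makes it increase along every continuation, so only
  -- an end can stop the walk.
  refine not_of_forall_exists_continuation hT (fun x y => F.Adj x y ∧ F.Reachable b y ∧
    distSum T x ≤ distSum T y ∧ distSum T b ≤ distSum T y) (fun x y h => hF h.1) ?_ a b
    ⟨hab, Reachable.refl b, hs, le_rfl⟩
  rintro x y ⟨h1, h2, h3, h4⟩
  have h5 : 1 < (F.neighborSet y).ncard := by
    by_contra h
    have := hcon y h2 (by omega)
    omega
  obtain ⟨z, hz, hzx⟩ := Set.exists_ne_of_one_lt_ncard h5 x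
  have := two_mul_distSum_lt hT (hF h1.symm) (hF hz) hzx.symm
  exact ⟨z, hzx, hz, h2.trans (Adj.reachable hz), by omega, by omega⟩

theorem exists_adj_dist_eq_dist_add_one {G : SimpleGraph V} {v r : V} (h : G.Reachable v r)
    (hne : v ≠ r) : ∃ w, G.Adj v w ∧ G.dist v r = G.dist w r + 1 := by
  obtain ⟨p, hp⟩ := h.exists_walk_length_eq_dist
  cases p with
  | nil => exact absurd rfl hne
  | @cons _ w _ hvw p =>
    refine ⟨w, hvw, le_antisymm ?_ ?_⟩
    · obtain ⟨q, hq⟩ := p.reachable.exists_walk_length_eq_dist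
      rw [← hq, ← Walk.length_cons hvw q]
      exact dist_le _
    · rw [← hp, Walk.length_cons]
      exact Nat.succ_le_succ (dist_le p)

/-- With one root per component, sending a non-root to the edge towards its root is a bijection from
the non-roots to the edges. -/
theorem card_connectedComponent_add_ncard_edgeSet [Finite V] {F : SimpleGraph V}
    (hF : F.IsAcyclic) : Nat.card F.ConnectedComponent + F.edgeSet.ncard = Nat.card V := by
  obtain ⟨t, ht⟩ : ∃ t : F.ConnectedComponent → V, ∀ C, F.connectedComponentMk (t C) = C :=
    ⟨_, Quot.out_eq⟩
  obtain ⟨e, he⟩ : ∃ e : V → V, ∀ v, e v = t (F.connectedComponentMk v) := ⟨_, fun _ => rfl⟩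
  have hr : ∀ v, F.Reachable v (e v) := fun v =>
    ConnectedComponent.exact (by rw [he, ht])
  have hee : ∀ v w, F.Adj v w → e v = e w := fun v w h => by
    rw [he, he, ConnectedComponent.sound h.reachable]
  choose! par hpar using fun v (hv : v ≠ e v) => exists_adj_dist_eq_dist_add_one (hr v) hv
  set S : Set V := Set.range t with hS
  have hmem : ∀ v, v ∉ S → v ≠ e v := fun v hv h => hv ⟨_, (h.trans (he v)).symm⟩
  have h1 : S.ncard = Nat.card F.ConnectedComponent := by
    rw [hS, ← Set.image_univ, Set.ncard_image_of_injective _ (Function.LeftInverse.injective ht), Set.ncard_univ]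
  have h2 : F.edgeSet = (fun v => s(v, par v)) '' Sᶜ := by
    ext x
    induction x with | _ a b => ?_
    have aux : ∀ a b, F.Adj a b → F.dist b (e b) = F.dist a (e a) + 1 →
        s(a, b) ∈ (fun v => s(v, par v)) '' Sᶜ := by
      intro a b hab hd
      have hbS : b ∉ S := by
        rintro ⟨c, rfl⟩
        rw [he (t c), ht, F.dist_self] at hd
        omega
      refine ⟨b, hbS, ?_⟩
      have h3 := hpar b (hmem b hbS)
      have h4 : par b = a := by
        refine eq_of_dist_eq_dist_add_one hF (hr b) h3.1 hab.symm h3.2 ?_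
        rw [← hee a b hab] at hd ⊢
        exact hd
      simp only [h4]
      exact Sym2.eq_swap
    constructor
    · intro hab
      rw [mem_edgeSet] at hab
      have hd := hF.dist_eq_dist_add_one_of_adj_of_reachable (e a) hab (hr a).symm
      simp only [F.dist_comm (u := e a)] at hd
      rcases hd with hd | hd
      · rw [Sym2.eq_swap]
        exact aux b a hab.symm (by rw [← hee a b hab]; omega)
      · exact aux a b hab (by rw [← hee a b hab]; omega)
    · rintro ⟨v, hv, hv'⟩
      rw [← hv']
      exact (hpar v (hmem v hv)).1
  have h3 : Set.InjOn (fun v => s(v, par v)) Sᶜ := by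
    intro v hv w hw hvw
    have h4 := hpar v (hmem v hv)
    have h5 := hpar w (hmem w hw)
    rcases Sym2.eq_iff.1 hvw with h | h
    · exact h.1
    · rw [h.2] at h4
      rw [← h.1, ← hee v w h4.1] at h5
      omega
  rw [h2, h3.ncard_image, ← h1, Set.ncard_add_ncard_compl]

/-! ### Zero forcing sets and spanning linear forests -/

/-- One end of every path of a path cover of a tree: these vertices form a zero forcing set. -/
theorem isZeroForcingSet_range [Finite V] {T F : SimpleGraph V} (hT : T.IsTree) (hFT : F ≤ T)
    (hF : IsLinear F) (e : F.ConnectedComponent → V)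
    (he : ∀ C, F.connectedComponentMk (e C) = C) (hend : ∀ C, (F.neighborSet (e C)).ncard ≤ 1) :
    IsZeroForcingSet T (Set.range e) := by
  obtain ⟨r, hr⟩ : ∃ r : V → V, ∀ v, r v = e (F.connectedComponentMk v) := ⟨_, fun _ => rfl⟩
  have hreach : ∀ v, F.Reachable v (r v) := fun v => ConnectedComponent.exact (by rw [hr, he])
  have hradj : ∀ v w, F.Adj v w → r v = r w := fun v w h => by
    rw [hr, hr, ConnectedComponent.sound h.reachable]
  have hpar : ∀ b, b ∉ Set.range e → ∃ a, F.Adj b a ∧ F.dist b (r b) = F.dist a (r b) + 1 :=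
    fun b hb => exists_adj_dist_eq_dist_add_one (hreach b) fun h => hb ⟨_, (h.trans (hr b)).symm⟩
  -- A vertex is the parent of at most one vertex: a root is an end, and a non-root spends one of
  -- its at most two edges on its own parent.
  have hchild : ∀ y x w, F.Adj x y → F.dist x (r x) = F.dist y (r x) + 1 →
      F.Adj w y → F.dist w (r w) = F.dist y (r w) + 1 → x = w := by
    intro y x w hxy hx hwy hw
    by_contra hne
    rw [hradj _ _ hxy] at hx
    rw [hradj _ _ hwy] at hw
    by_cases hy : y ∈ Set.range e
    · obtain ⟨C, rfl⟩ := hy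
      exact hne ((Set.ncard_le_one (Set.toFinite _)).1 (hend C) x hxy.symm w hwy.symm)
    · obtain ⟨a, hya, ha⟩ := hpar y hy
      have h3 : ({x, w, a} : Set V).ncard = 3 := by
        rw [Set.ncard_eq_three]
        refine ⟨x, w, a, hne, ?_, ?_, rfl⟩ <;> rintro rfl <;> omega
      have h4 : ({x, w, a} : Set V) ⊆ F.neighborSet y := by
        rintro z (rfl | rfl | rfl)
        exacts [hxy.symm, hwy.symm, hya]
      have := Set.ncard_le_ncard h4
      have := hF y
      omega
  set A : V → Prop := Active T (Set.range e) with hA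
  -- The darts record a chase for the cause of inactivity. An inactive vertex leads to its parent;
  -- an active parent that fails to force leads to another inactive neighbour, which is not its
  -- child by `hchild`.
  have hno := not_of_forall_exists_continuation hT
    (fun x y => T.Adj x y ∧ ((¬ A y ∧ ¬ (F.Adj y x ∧ F.dist y (r y) = F.dist x (r y) + 1)) ∨
      (¬ A x ∧ F.Adj x y ∧ F.dist x (r x) = F.dist y (r x) + 1))) (fun x y h => h.1) ?_
  · intro b
    by_contra hb
    obtain ⟨a, hba, ha⟩ := hpar b fun h => hb (Active.init b h)
    exact hno b a ⟨hFT hba, Or.inr ⟨hb, hba, ha⟩⟩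
  · rintro x y ⟨hxy, ⟨hy, hnot⟩ | ⟨hx, hFxy, hd⟩⟩
    · obtain ⟨z, hyz, hz⟩ := hpar y fun h => hy (Active.init y h)
      exact ⟨z, by rintro rfl; exact hnot ⟨hyz, hz⟩, hFT hyz, Or.inr ⟨hy, hyz, hz⟩⟩
    · by_cases hy : A y
      · have : ∃ w, T.Adj y w ∧ w ≠ x ∧ ¬ A w := by
          by_contra! hcon
          exact hx (Active.force y x hy hxy.symm hcon)
        obtain ⟨w, hyw, hwx, hw⟩ := this
        exact ⟨w, hwx, hyw, Or.inl ⟨hw, fun h => hwx (hchild y x w hFxy hd h.1 h.2).symm⟩⟩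
      · obtain ⟨z, hyz, hz⟩ := hpar y fun h => hy (Active.init y h)
        refine ⟨z, ?_, hFT hyz, Or.inr ⟨hy, hyz, hz⟩⟩
        rintro rfl
        rw [hradj _ _ hFxy] at hd
        omega

/-- The forces of a zero forcing process form a subgraph of maximum degree at most two. -/
theorem IsZeroForcingSet.exists_isLinear [Finite V] {T : SimpleGraph V} {S : Set V}
    (hS : IsZeroForcingSet T S) :
    ∃ F ≤ T, IsLinear F ∧ Nat.card V ≤ S.ncard + F.edgeSet.ncard := by
  -- Invariants: vertices outside `A` are isolated in `F`, and a vertex with a neighbour outside `A`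
  -- still has room for one more edge. Each force adds one vertex to `A` and one edge to `F`.
  obtain ⟨A, ⟨hSA, F, hFT, hF, h0, h1, hcard⟩, hmax⟩ := (Set.toFinite {A : Set V | S ⊆ A ∧
    ∃ F ≤ T, IsLinear F ∧ (∀ v, v ∉ A → F.neighborSet v = ∅) ∧
      (∀ v w, T.Adj v w → w ∉ A → (F.neighborSet v).ncard ≤ 1) ∧
      A.ncard ≤ S.ncard + F.edgeSet.ncard}).exists_maximalFor (fun A => A.ncard) _
    ⟨S, subset_rfl, ⊥, bot_le, fun v => by simp [neighborSet], fun v _ => by simp [neighborSet],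
      fun v _ _ _ => by simp [neighborSet], by simp⟩
  have hall : ∀ v, v ∈ A := by
    intro v
    induction hS v with
    | init v hv => exact hSA hv
    | force a b _ hab hrest iha ihrest =>
      by_contra hb
      have hna : ¬ F.Adj a b := fun h => by
        have : a ∈ F.neighborSet b := h.symm
        rw [h0 b hb] at this
        exact this
      have hlt : A.ncard < (insert b A).ncard := by
        rw [Set.ncard_insert_of_notMem hb]; omega
      refine hlt.not_ge (hmax (j := insert b A) ⟨hSA.trans (Set.subset_insert _ _), F ⊔ edge a b,
        sup_le hFT (by rwa [edge_le_iff, or_iff_right hab.ne]),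
        isLinear_sup_edge hF (h1 a b hab hb) (by rw [h0 b hb]; simp), ?_, ?_, ?_⟩ hlt.le)
      · intro v hv
        rw [Set.mem_insert_iff, not_or] at hv
        rw [neighborSet_sup_edge_of_ne (by rintro rfl; exact hv.2 iha) hv.1, h0 v hv.2]
      · intro v w hvw hw
        rw [Set.mem_insert_iff, not_or] at hw
        by_cases hva : v = a
        · subst hva
          exact absurd (ihrest w hvw hw.1) hw.2
        by_cases hvb : v = b
        · subst hvb
          rw [edge_comm]
          refine (ncard_neighborSet_sup_edge_le _ _ _).trans ?_
          rw [h0 v hb]; simp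
        rw [neighborSet_sup_edge_of_ne hva hvb]
        exact h1 v w hvw hw.2
      · rw [Set.ncard_insert_of_notMem hb, edgeSet_ncard_sup_edge hna hab.ne]
        omega
  refine ⟨F, hFT, hF, ?_⟩
  rwa [Set.eq_univ_of_forall hall, Set.ncard_univ] at hcard

/-- Any zero forcing set has at least as many vertices as `F` has components: its forces form a
linear subgraph, which has no more edges than `F`. -/
theorem IsMaxLinear.isMinZeroForcingSet_range [Finite V] {T F : SimpleGraph V} (hT : T.IsTree)
    (hF : IsMaxLinear T F) (e : F.ConnectedComponent → V)
    (he : ∀ C, F.connectedComponentMk (e C) = C) (hend : ∀ C, (F.neighborSet (e C)).ncard ≤ 1) :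
    IsMinZeroForcingSet T (Set.range e) := by
  refine ⟨isZeroForcingSet_range hT hF.1.1 hF.1.2 e he hend, fun S' hS' => ?_⟩
  obtain ⟨F', h1, h2, h3⟩ := hS'.exists_isLinear
  have h4 := hF.2 F' h1 h2
  have h5 := card_connectedComponent_add_ncard_edgeSet (hT.isAcyclic.anti hF.1.1)
  have h6 : (Set.range e).ncard = Nat.card F.ConnectedComponent := by
    rw [← Set.image_univ, Set.ncard_image_of_injective _ (Function.LeftInverse.injective he),
      Set.ncard_univ]
  rw [← (Set.toFinite _).cast_ncard_eq, ← (Set.toFinite _).cast_ncard_eq, Nat.cast_le]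
  omega

/-! ### Ends of paths under iso-uniqueness -/

/-- In an iso-unique zero forcing tree both ends of a path of a minimum path cover have the same
distance sum. -/
theorem distSum_eq_of_reachable [Fintype V] {T F : SimpleGraph V} (hT : T.IsTree)
    (hiso : IsIsoUniqueZeroForcing T) (hF : IsMaxLinear T F) {u v : V}
    (hu : (F.neighborSet u).ncard ≤ 1) (hv : (F.neighborSet v).ncard ≤ 1)
    (huv : F.Reachable u v) : distSum T u = distSum T v := by
  classical
  have hex : ∀ C : F.ConnectedComponent, ∃ w, F.connectedComponentMk w = C ∧
      (F.neighborSet w).ncard ≤ 1 := by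
    intro C
    induction C using ConnectedComponent.ind with | _ w => ?_
    obtain ⟨r, h1, h2, -⟩ := exists_end (hT.isAcyclic.anti hF.1.1) w
    exact ⟨r, ConnectedComponent.sound h1.symm, h2⟩
  choose t ht htend using hex
  set C := F.connectedComponentMk u with hC
  have hmin : ∀ w, F.connectedComponentMk w = C → (F.neighborSet w).ncard ≤ 1 →
      (∀ D, F.connectedComponentMk (Function.update t C w D) = D) ∧
      IsMinZeroForcingSet T (Set.range (Function.update t C w)) := by
    intro w hw hwend
    have h1 : ∀ D, F.connectedComponentMk (Function.update t C w D) = D := by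
      intro D
      by_cases hD : D = C
      · subst hD; simpa using hw
      · simpa [hD] using ht D
    refine ⟨h1, hF.isMinZeroForcingSet_range hT _ h1 fun D => ?_⟩
    by_cases hD : D = C
    · subst hD; simpa using hwend
    · simpa [hD] using htend D
  obtain ⟨hu1, hu2⟩ := hmin u rfl hu
  obtain ⟨hv1, hv2⟩ := hmin v (ConnectedComponent.sound huv.symm) hv
  obtain ⟨φ, hφ⟩ := hiso _ _ hu2 hv2
  have hsum : ∀ w, (∀ D, F.connectedComponentMk (Function.update t C w D) = D) →
      ∑ x ∈ (Set.range (Function.update t C w)).toFinset, distSum T x =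
        distSum T w + ∑ D ∈ Finset.univ.erase C, distSum T (t D) := by
    intro w hw
    rw [Set.toFinset_range, Finset.sum_image (Function.LeftInverse.injective hw).injOn,
      ← Finset.add_sum_erase _ _ (Finset.mem_univ C), Function.update_self]
    congr 1
    refine Finset.sum_congr rfl fun D hD => ?_
    rw [Function.update_of_ne (Finset.ne_of_mem_erase hD)]
  -- Both sets have the same total distance sum; the contributions of the components other than `C`
  -- cancel.
  have h1 : ∑ x ∈ (Set.range (Function.update t C v)).toFinset, distSum T x =
      ∑ x ∈ (Set.range (Function.update t C u)).toFinset, distSum T x := by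
    have h2 : (Set.range (Function.update t C v)).toFinset =
        (Set.range (Function.update t C u)).toFinset.image φ := by
      ext x
      simp only [← hφ, Set.mem_toFinset, Finset.mem_image, Set.mem_image]
    rw [h2, Finset.sum_image φ.injective.injOn]
    exact Finset.sum_congr rfl fun x _ => distSum_map_iso hT.connected φ x
  rw [hsum u hu1, hsum v hv1] at h1
  omega

theorem reachable_of_forall_adj {F F' : SimpleGraph V} {u v : V} (h : F.Reachable u v)
    (h' : ∀ a b, F.Reachable u a → F.Adj a b → F'.Adj a b) : F'.Reachable u v := by
  obtain ⟨p⟩ := h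
  induction p with
  | nil => exact Reachable.refl _
  | cons hab p ih =>
    exact (h' _ _ (Reachable.refl _) hab).reachable.trans
      (ih fun a b ha => h' a b (hab.reachable.trans ha))

/-- In an iso-unique zero forcing tree the ends of the paths of a minimum path cover have degree
at most one in the tree. -/
theorem ncard_neighborSet_le_one_of_end [Fintype V] {T F : SimpleGraph V} (hT : T.IsTree)
    (hiso : IsIsoUniqueZeroForcing T) (hF : IsMaxLinear T F) {u : V}
    (hu : (F.neighborSet u).ncard ≤ 1) : (T.neighborSet u).ncard ≤ 1 := by
  by_contra! hlt
  have hw : ∃ w, T.Adj u w ∧ ¬ F.Adj u w ∧ distSum T u < distSum T w := by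
    by_cases hy : ∃ y, F.Adj u y
    · obtain ⟨y, hy⟩ := hy
      obtain ⟨w, hw, hwy⟩ := Set.exists_ne_of_one_lt_ncard hlt y
      refine ⟨w, hw, fun h => hwy ((Set.ncard_le_one (Set.toFinite _)).1 hu w h y hy), ?_⟩
      have h1 := two_mul_distSum_lt hT hw (hF.1.1 hy) hwy
      -- Otherwise `distSum` increases from `u` to `y` and onwards along the path, so its other end
      -- has a larger sum.
      by_contra hle
      obtain ⟨r, h2, h3, h4⟩ := exists_end_of_distSum_le hT hF.1.1 hy (by omega)
      have := distSum_eq_of_reachable hT hiso hF hu h3 (hy.reachable.trans h2)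
      omega
    · obtain ⟨a, ha, b, hb, hab⟩ := (Set.one_lt_ncard (Set.toFinite _)).1 hlt
      have h1 := two_mul_distSum_lt hT ha hb hab
      by_cases h2 : distSum T u < distSum T a
      · exact ⟨a, ha, fun h => hy ⟨a, h⟩, h2⟩
      · exact ⟨b, hb, fun h => hy ⟨b, h⟩, by omega⟩
  obtain ⟨w, hw, hFw, hs⟩ := hw
  have hnr : ¬ F.Reachable u w := fun h =>
    hFw (adj_of_reachable_of_le hT.isAcyclic hF.1.1 hw h)
  obtain ⟨x, y, hxy, hN⟩ := Set.ncard_eq_two.1 (hF.ncard_eq_two hw hFw hu)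
  have hwx : F.Adj w x := by rw [← mem_neighborSet, hN]; simp
  have hwy : F.Adj w y := by rw [← mem_neighborSet, hN]; simp
  -- After the exchange, the old path of `u` continues through `w` and `y`, with `distSum` rising
  -- from `u` up to the new end `r`. The far end `q` of the old path survives and has the sum of
  -- `u`, contradicting equality of ends.
  obtain ⟨hF', -⟩ := hF.swap hw hFw hu hwx
  set F' := F \ edge w x ⊔ edge u w with hF'def
  have huw' : F'.Adj u w := by simp [hF'def, edge_adj, hw.ne]
  have hwy' : F'.Adj w y := by
    refine Or.inl ⟨hwy, fun h => ?_⟩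
    have := (edge_adj w x w y).1 h
    have := hwx.ne
    have := hwy.ne
    grind
  have hyu : y ≠ u := by rintro rfl; exact hFw hwy.symm
  have hsy := two_mul_distSum_lt hT hw.symm (hF.1.1 hwy) hyu.symm
  obtain ⟨r, hr1, hr2, hr3⟩ := exists_end_of_distSum_le hT hF'.1.1 hwy' (by omega)
  obtain ⟨q, hq1, hq2, hq3⟩ := exists_end (hT.isAcyclic.anti hF.1.1) u
  have hqw : q ≠ w := by rintro rfl; exact hnr hq1
  have hqx : q ≠ x := by rintro rfl; exact hnr (hq1.trans hwx.symm.reachable)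
  have hq4 : F'.Reachable u q := by
    refine reachable_of_forall_adj hq1 fun a b ha hab => Or.inl ⟨hab, fun h => ?_⟩
    rcases ((edge_adj w x a b).1 h).1 with ⟨rfl, rfl⟩ | ⟨rfl, rfl⟩
    · exact hnr ha
    · exact hnr (ha.trans hab.reachable)
  have hsub : (F \ edge w x).neighborSet q ⊆ F.neighborSet q := fun z hz => sdiff_le (a := F) hz
  have hq5 : (F'.neighborSet q).ncard ≤ 1 := by
    by_cases hqu : q = u
    · have h1 := hq3 hqu
      subst hqu
      refine (ncard_neighborSet_sup_edge_le _ _ _).trans ?_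
      rw [Set.subset_empty_iff.1 (hsub.trans h1.subset)]
      simp
    · rw [hF'def, neighborSet_sup_edge_of_ne hqu hqw]
      exact (Set.ncard_le_ncard hsub).trans hq2
  have h1 := distSum_eq_of_reachable hT hiso hF hu hq2 hq1
  have h2 := distSum_eq_of_reachable hT hiso hF' hq5 hr2
    (hq4.symm.trans (huw'.reachable.trans (hwy'.reachable.trans hr1)))
  omega

/-! ### Path covers and spanning linear forests -/

/-- The spanning subgraph formed by the edges of the members of `P`. -/
def coverGraph {G : SimpleGraph V} (P : Set G.Subgraph) : SimpleGraph V := (sSup P).spanningCoe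

theorem coverGraph_adj {G : SimpleGraph V} {P : Set G.Subgraph} {a b : V} :
    (coverGraph P).Adj a b ↔ ∃ H ∈ P, H.Adj a b := by
  simp [coverGraph, Subgraph.sSup_adj]

theorem coverGraph_le {G : SimpleGraph V} (P : Set G.Subgraph) : coverGraph P ≤ G :=
  Subgraph.spanningCoe_le _

theorem ncard_neighborSet_toSubgraph_le_two {G : SimpleGraph V} {a b : V} {p : G.Walk a b}
    (hp : p.IsPath) (x : V) : (p.toSubgraph.neighborSet x).ncard ≤ 2 := by
  by_cases hx : x ∈ p.support
  · obtain ⟨i, rfl, hi⟩ := Walk.mem_support_iff_exists_getVert.1 hx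
    by_cases hnil : p.Nil
    · cases hnil
      have : ∀ x, (Walk.nil : G.Walk a a).toSubgraph.neighborSet x = ∅ := by
        intro x; ext y; simp
      rw [this]; simp
    rcases Nat.eq_zero_or_pos i with rfl | h0
    · rw [Walk.getVert_zero, hp.neighborSet_toSubgraph_startpoint hnil]; simp
    rcases hi.eq_or_lt with rfl | hlt
    · rw [Walk.getVert_length, hp.neighborSet_toSubgraph_endpoint hnil]; simp
    · exact (hp.ncard_neighborSet_toSubgraph_internal_eq_two h0.ne' hlt).le
  · have : p.toSubgraph.neighborSet x = ∅ := by
      ext y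
      simp only [Subgraph.mem_neighborSet, Set.mem_empty_iff_false, iff_false]
      exact fun h => hx (Walk.mem_support_of_adj_toSubgraph h)
    rw [this]; simp

section PathCover

variable {G : SimpleGraph V} {P : Set G.Subgraph}

theorem IsPathCover.eq_of_mem (hP : IsPathCover G P) {H K : G.Subgraph} (hH : H ∈ P) (hK : K ∈ P)
    {v : V} (hvH : v ∈ H.verts) (hvK : v ∈ K.verts) : H = K := by
  by_contra h
  exact Set.disjoint_left.1 (hP.2.1 H hH K hK h) hvH hvK

theorem IsPathCover.mem_verts_iff_reachable (hP : IsPathCover G P) {H : G.Subgraph} (hH : H ∈ P)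
    {v w : V} (hv : v ∈ H.verts) : w ∈ H.verts ↔ (coverGraph P).Reachable v w := by
  constructor
  · intro hw
    obtain ⟨-, a, b, p, -, rfl⟩ := hP.1 H hH
    have := p.toSubgraph_connected.preconnected ⟨v, hv⟩ ⟨w, hw⟩
    exact this.map (⟨fun x => x.1, fun h => coverGraph_adj.2 ⟨_, hH, h⟩⟩ :
      p.toSubgraph.coe →g coverGraph P)
  · rintro ⟨p⟩
    induction p with
    | nil => exact hv
    | cons h p ih =>
      obtain ⟨K, hK, hadj⟩ := coverGraph_adj.1 h
      obtain rfl := hP.eq_of_mem hH hK hv hadj.fst_mem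
      exact ih hadj.snd_mem

theorem IsPathCover.isLinear_coverGraph (hP : IsPathCover G P) : IsLinear (coverGraph P) := by
  intro v
  obtain ⟨H, hH, hv⟩ := hP.2.2 v
  have : (coverGraph P).neighborSet v = H.neighborSet v := by
    ext w
    simp only [mem_neighborSet, Subgraph.mem_neighborSet, coverGraph_adj]
    refine ⟨?_, fun h => ⟨H, hH, h⟩⟩
    rintro ⟨K, hK, h⟩
    rwa [hP.eq_of_mem hH hK hv h.fst_mem]
  rw [this]
  obtain ⟨-, a, b, p, hp, rfl⟩ := hP.1 H hH
  exact ncard_neighborSet_toSubgraph_le_two hp v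

theorem IsInducedPath.verts_nonempty {H : G.Subgraph} (hH : IsInducedPath G H) :
    H.verts.Nonempty := by
  obtain ⟨-, a, b, p, -, rfl⟩ := hH
  exact ⟨a, by simp⟩

theorem IsPathCover.ncard_eq (hP : IsPathCover G P) :
    P.ncard = Nat.card (coverGraph P).ConnectedComponent := by
  choose g hgP hg using hP.2.2
  have hiff : ∀ v w, (coverGraph P).Reachable v w ↔ g v = g w := by
    intro v w
    rw [← hP.mem_verts_iff_reachable (hgP v) (hg v)]
    exact ⟨fun h => hP.eq_of_mem (hgP v) (hgP w) h (hg w), fun h => h ▸ hg w⟩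
  let f : (coverGraph P).ConnectedComponent → G.Subgraph :=
    Quot.lift g fun v w h => (hiff v w).1 h
  have hf : Function.Injective f := by
    intro C D
    induction C using ConnectedComponent.ind
    induction D using ConnectedComponent.ind
    exact fun h => ConnectedComponent.sound ((hiff _ _).2 h)
  have hrange : P = Set.range f := by
    ext H
    constructor
    · intro hH
      obtain ⟨v, hv⟩ := (hP.1 H hH).verts_nonempty
      exact ⟨(coverGraph P).connectedComponentMk v, hP.eq_of_mem (hgP v) hH (hg v) hv⟩
    · rintro ⟨C, rfl⟩
      induction C using ConnectedComponent.ind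
      exact hgP _
  conv_lhs => rw [hrange]
  rw [← Set.image_univ, Set.ncard_image_of_injective _ hf, Set.ncard_univ]

/-- The members have the components of the cover graph as vertex sets, and being induced they are
determined by these. -/
theorem IsPathCover.subset_of_coverGraph_eq {Q : Set G.Subgraph} (hP : IsPathCover G P)
    (hQ : IsPathCover G Q) (h : coverGraph P = coverGraph Q) : P ⊆ Q := by
  intro H hH
  obtain ⟨v, hv⟩ := (hP.1 H hH).verts_nonempty
  obtain ⟨K, hK, hvK⟩ := hQ.2.2 v
  have hverts : H.verts = K.verts := by
    ext w
    rw [hP.mem_verts_iff_reachable hH hv, hQ.mem_verts_iff_reachable hK hvK, h]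
  have : H = K := by
    refine Subgraph.ext hverts ?_
    ext a b
    constructor
    · exact fun hab => (hQ.1 K hK).1 (hverts ▸ hab.fst_mem) (hverts ▸ hab.snd_mem) hab.adj_sub
    · exact fun hab => (hP.1 H hH).1 (hverts ▸ hab.fst_mem) (hverts ▸ hab.snd_mem) hab.adj_sub
  rwa [this]

end PathCover

/-- The components of a spanning linear forest of an acyclic graph are induced paths. -/
theorem isInducedPath_induce_supp [Finite V] {G F : SimpleGraph V} (hG : G.IsAcyclic) (hFG : F ≤ G)
    (hF : IsLinear F) (C : F.ConnectedComponent) :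
    IsInducedPath G ((⊤ : G.Subgraph).induce C.supp) := by
  classical
  have hFac := hG.anti hFG
  refine ⟨fun v hv w hw h => by simpa using ⟨hv, hw, h⟩, ?_⟩
  induction C using ConnectedComponent.ind with | _ v => ?_
  obtain ⟨u, hvu, hu, -⟩ := exists_end hFac v
  obtain ⟨r, hur, hr, hne⟩ := exists_end hFac u
  obtain ⟨p, hp⟩ := hur.exists_isPath
  -- The path `p` between two ends already uses every `F`-edge at its vertices, so it fills the
  -- component. The equation `r = u` means an isolated vertex.
  have hN : ∀ x ∈ p.support, p.toSubgraph.neighborSet x = F.neighborSet x := by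
    intro x hx
    have hsub : p.toSubgraph.neighborSet x ⊆ F.neighborSet x := fun y hy => hy.adj_sub
    refine Set.eq_of_subset_of_ncard_le hsub ?_
    obtain ⟨i, rfl, hi⟩ := Walk.mem_support_iff_exists_getVert.1 hx
    by_cases hnil : p.Nil
    · have hru := hnil.eq.symm
      have : p.getVert i = u := by
        rw [Walk.length_eq_zero_iff.2 hnil, Nat.le_zero] at hi
        rw [hi, Walk.getVert_zero]
      rw [this, hne hru]
      simp
    rcases Nat.eq_zero_or_pos i with rfl | h0
    · rw [Walk.getVert_zero, hp.neighborSet_toSubgraph_startpoint hnil]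
      simpa using hu
    rcases hi.eq_or_lt with rfl | hlt
    · rw [Walk.getVert_length, hp.neighborSet_toSubgraph_endpoint hnil]
      simpa using hr
    · rw [hp.ncard_neighborSet_toSubgraph_internal_eq_two h0.ne' hlt]
      exact hF _
  have hsupp : ∀ w, w ∈ p.support ↔ F.Reachable w v := by
    intro w
    constructor
    · exact fun hw => ((p.takeUntil w hw).reachable.symm).trans hvu.symm
    · intro hw
      have : ∀ a b, F.Reachable a b → a ∈ p.support → b ∈ p.support := by
        rintro a b ⟨q⟩ ha
        induction q with
        | nil => exact ha
        | cons h q ih =>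
          refine ih ?_
          rw [← mem_neighborSet, ← hN _ ha, Subgraph.mem_neighborSet] at h
          exact Walk.mem_support_of_adj_toSubgraph h.symm
      exact this u w (hvu.symm.trans hw.symm) p.start_mem_support
  refine ⟨u, r, p.mapLe hFG, by simpa using hp, Subgraph.ext ?_ ?_⟩
  · ext w
    simp [hsupp]
  · ext a b
    rw [Walk.adj_toSubgraph_mapLe]
    simp only [Subgraph.induce_adj, ConnectedComponent.mem_supp_iff, ConnectedComponent.eq,
      Subgraph.top_adj]
    constructor
    · intro h
      exact ⟨(hsupp a).1 (Walk.mem_support_of_adj_toSubgraph h),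
        (hsupp b).1 (Walk.mem_support_of_adj_toSubgraph h.symm), hFG h.adj_sub⟩
    · rintro ⟨ha, hb, hab⟩
      have h1 := adj_of_reachable_of_le hG hFG hab (ha.trans hb.symm)
      rwa [← Subgraph.mem_neighborSet, hN a ((hsupp a).2 ha)]

theorem exists_isPathCover [Finite V] {G F : SimpleGraph V} (hG : G.IsAcyclic) (hFG : F ≤ G)
    (hF : IsLinear F) :
    ∃ P, IsPathCover G P ∧ P.ncard = Nat.card F.ConnectedComponent := by
  have hinj : Function.Injective
      fun C : F.ConnectedComponent => (⊤ : G.Subgraph).induce C.supp := fun C D h =>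
    ConnectedComponent.supp_injective (congrArg Subgraph.verts h)
  refine ⟨Set.range fun C : F.ConnectedComponent => (⊤ : G.Subgraph).induce C.supp, ⟨?_, ?_, ?_⟩, ?_⟩
  · rintro _ ⟨C, rfl⟩
    exact isInducedPath_induce_supp hG hFG hF C
  · rintro _ ⟨C, rfl⟩ _ ⟨D, rfl⟩ hne
    refine Set.disjoint_left.2 fun v hv hw => hne ?_
    obtain rfl : C = D := hv.symm.trans hw
    rfl
  · exact fun v => ⟨_, ⟨F.connectedComponentMk v, rfl⟩, rfl⟩
  · rw [← Set.image_univ, Set.ncard_image_of_injective _ hinj, Set.ncard_univ]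

theorem isMinPathCover_iff [Finite V] {G : SimpleGraph V} (hG : G.IsAcyclic) {P : Set G.Subgraph}
    (hP : IsPathCover G P) : IsMinPathCover G P ↔ IsMaxLinear G (coverGraph P) := by
  have hcard : ∀ {F : SimpleGraph V}, F ≤ G →
      Nat.card F.ConnectedComponent + F.edgeSet.ncard = Nat.card V := fun h =>
    card_connectedComponent_add_ncard_edgeSet (hG.anti h)
  have h1 := hcard (coverGraph_le P)
  have h2 := hP.ncard_eq
  constructor
  · intro h
    refine ⟨⟨coverGraph_le P, hP.isLinear_coverGraph⟩, fun F hFG hF => ?_⟩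
    obtain ⟨Q, hQ, hQF⟩ := exists_isPathCover hG hFG hF
    have h3 := h.2 Q hQ
    rw [← (Set.toFinite _).cast_ncard_eq, ← (Set.toFinite _).cast_ncard_eq, Nat.cast_le] at h3
    have h4 := hcard hFG
    omega
  · refine fun h => ⟨hP, fun Q hQ => ?_⟩
    have h3 := h.2 _ (coverGraph_le Q) hQ.isLinear_coverGraph
    have h4 := hcard (coverGraph_le Q)
    have h5 := hQ.ncard_eq
    rw [← (Set.toFinite _).cast_ncard_eq, ← (Set.toFinite _).cast_ncard_eq, Nat.cast_le]
    omega

theorem exists_isMinPathCover [Finite V] {G : SimpleGraph V} (hG : G.IsAcyclic) :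
    ∃ P, IsMinPathCover G P := by
  obtain ⟨F, hF⟩ := exists_isMaxLinear G
  obtain ⟨P, hP, hPF⟩ := exists_isPathCover hG hF.1.1 hF.1.2
  refine ⟨P, (isMinPathCover_iff hG hP).2 ⟨⟨coverGraph_le P, hP.isLinear_coverGraph⟩,
    fun F' h1 h2 => (hF.2 F' h1 h2).trans ?_⟩⟩
  have h1 := card_connectedComponent_add_ncard_edgeSet (hG.anti (coverGraph_le P))
  have h2 := card_connectedComponent_add_ncard_edgeSet (hG.anti hF.1.1)
  have h3 := hP.ncard_eq
  omega

/-! ### Leaf reductions -/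

theorem eq_of_mem_leavesAt {T : SimpleGraph V} {v w x : V} (hx : x ∈ leavesAt T v)
    (hxw : T.Adj x w) : w = v := by
  obtain ⟨y, hy⟩ := Set.encard_eq_one.1 hx.2
  have h1 : w ∈ T.neighborSet x := hxw
  have h2 : v ∈ T.neighborSet x := hx.1.symm
  rw [hy, Set.mem_singleton_iff] at h1 h2
  rw [h1, h2]

/-- The neighbour is itself retained: a removed vertex is a leaf, so it cannot have more than two
leaf neighbours. -/
theorem exists_mem_and_two_lt_of_notMem {T : SimpleGraph V} {W : Set V}
    (hW : IsLeafReduction T W) {x : V} (hx : x ∉ W) :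
    ∃ v ∈ W, 2 < (leavesAt T v).encard ∧ x ∈ leavesAt T v := by
  obtain ⟨v, hv, hxv⟩ := hW.1 x hx
  refine ⟨v, ?_, hv, hxv⟩
  by_contra hvW
  obtain ⟨w, -, hvw⟩ := hW.1 v hvW
  have h1 : leavesAt T v ⊆ {w} := fun y hy => eq_of_mem_leavesAt hvw hy.1
  have h2 := Set.encard_le_encard h1
  rw [Set.encard_singleton] at h2
  exact absurd (hv.trans_le h2) (by norm_num)

/-- The map `f` fixes `W` and collapses each removed leaf onto its neighbour, so it carries walks of
`T` to walks within `W`. -/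
theorem isTree_induce {T : SimpleGraph V} (hT : T.IsTree) {W : Set V}
    (hW : IsLeafReduction T W) : (T.induce W).IsTree := by
  classical
  have hf : ∀ x, ∃ y : W, (x ∈ W → y.1 = x) ∧ (x ∉ W → x ∈ leavesAt T y.1) := by
    intro x
    by_cases hx : x ∈ W
    · exact ⟨⟨x, hx⟩, fun _ => rfl, fun h => absurd hx h⟩
    · obtain ⟨v, hv, -, hxv⟩ := exists_mem_and_two_lt_of_notMem hW hx
      exact ⟨⟨v, hv⟩, fun h => absurd h hx, fun _ => hxv⟩
  choose f hf1 hf2 using hf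
  have hstep : ∀ a b, T.Adj a b → a ∉ W → f a = f b := by
    intro a b hab ha
    have h1 := eq_of_mem_leavesAt (hf2 a ha) hab
    have hb : b ∈ W := h1 ▸ (f a).2
    exact Subtype.ext (by rw [hf1 b hb, h1])
  have hreach : ∀ a b, T.Reachable a b → (T.induce W).Reachable (f a) (f b) := by
    rintro a b ⟨p⟩
    induction p with
    | nil => exact Reachable.refl _
    | @cons a c b hac p ih =>
      refine Reachable.trans ?_ ih
      by_cases ha : a ∈ W
      · by_cases hc : c ∈ W
        · refine Adj.reachable ?_
          rw [comap_adj]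
          simpa [hf1 a ha, hf1 c hc] using hac
        · rw [hstep c a hac.symm hc]
      · rw [hstep a c hac ha]
  have hfW : ∀ x : W, f x = x := fun x => Subtype.ext (hf1 x x.2)
  obtain ⟨x⟩ := hT.connected.nonempty
  have : Nonempty W := ⟨f x⟩
  refine ⟨⟨fun a b => ?_⟩, hT.isAcyclic.induce W⟩
  rw [← hfW a, ← hfW b]
  exact hreach _ _ (hT.connected _ _)

/-- Some maximum linear subgraph avoids the removed leaves. -/
theorem exists_isMaxLinear_forall_mem [Finite V] {T : SimpleGraph V} {W : Set V}
    (hW : IsLeafReduction T W) :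
    ∃ F, IsMaxLinear T F ∧ ∀ x y, F.Adj x y → x ∈ W := by
  obtain ⟨F₀, hF₀⟩ := exists_isMaxLinear T
  obtain ⟨F, hF, hmin⟩ := (Set.toFinite {F | IsMaxLinear T F}).exists_minimalFor
    (fun F => {x | x ∉ W ∧ ∃ y, F.Adj x y}.ncard) _ ⟨F₀, hF₀⟩
  refine ⟨F, hF, fun x v' hxv' => ?_⟩
  by_contra hx
  obtain ⟨v, hvW, hv2, hxv⟩ := exists_mem_and_two_lt_of_notMem hW hx
  obtain rfl := eq_of_mem_leavesAt hxv (hF.1.1 hxv')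
  -- The removed leaf `x` occupies one of at most two edges at `v'`, so one of the two retained
  -- leaves is free to take its place.
  have hy : ∃ y ∈ leavesAt T v' ∩ W, ¬ F.Adj y v' := by
    by_contra! hcon
    have h1 : insert x (leavesAt T v' ∩ W) ⊆ F.neighborSet v' := by
      rintro z (rfl | hz)
      exacts [hxv'.symm, (hcon z hz).symm]
    have h2 : (insert x (leavesAt T v' ∩ W)).ncard = 3 := by
      rw [Set.ncard_insert_of_notMem fun h => hx h.2, Set.ncard_def, hW.2 v' hv2]
      rfl
    have h3 := Set.ncard_le_ncard h1
    have := hF.1.2 v'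
    omega
  obtain ⟨y, ⟨hyv, hyW⟩, hFy⟩ := hy
  have hNy : (F.neighborSet y).ncard ≤ 1 := by
    rw [Set.ncard_le_one (Set.toFinite _)]
    intro a ha b hb
    rw [eq_of_mem_leavesAt hyv (hF.1.1 ha), eq_of_mem_leavesAt hyv (hF.1.1 hb)]
  obtain ⟨hF', -⟩ := hF.swap hyv.1.symm hFy hNy hxv'.symm
  have hlt : {z | z ∉ W ∧ ∃ t, (F \ edge v' x ⊔ edge y v').Adj z t}.ncard <
      {z | z ∉ W ∧ ∃ t, F.Adj z t}.ncard := by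
    refine Set.ncard_lt_ncard (Set.ssubset_iff_subset_ne.2 ⟨?_, fun h => ?_⟩)
    · rintro z ⟨hz, t, h | h⟩
      · exact ⟨hz, t, sdiff_le (a := F) h⟩
      · rcases ((edge_adj _ _ _ _).1 h).1 with ⟨rfl, rfl⟩ | ⟨rfl, rfl⟩
        · exact absurd hyW hz
        · exact absurd hvW hz
    · have hxm : x ∈ {z | z ∉ W ∧ ∃ t, F.Adj z t} := ⟨hx, v', hxv'⟩
      rw [← h] at hxm
      obtain ⟨-, t, ht⟩ := hxm
      obtain rfl := eq_of_mem_leavesAt hxv (hF'.1.1 ht)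
      rcases ht with ht | ht
      · exact ht.2 ((edge_adj _ _ _ _).2 ⟨Or.inr ⟨rfl, rfl⟩, ht.1.ne⟩)
      · rcases ((edge_adj _ _ _ _).1 ht).1 with ⟨rfl, -⟩ | ⟨rfl, -⟩
        · exact hx hyW
        · exact hx hvW
  exact hlt.not_ge (hmin (j := F \ edge v' x ⊔ edge y v') hF' hlt.le)

theorem isLinear_map [Finite V] {W : Set V} {F : SimpleGraph W} (hF : IsLinear F) :
    IsLinear (F.map (Function.Embedding.subtype (· ∈ W))) := by
  intro v
  by_cases hv : v ∈ W
  · have := F.neighborSet_map (Function.Embedding.subtype (· ∈ W)) ⟨v, hv⟩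
    rw [Function.Embedding.subtype_apply] at this
    rw [this, Set.ncard_image_of_injective _ (Function.Embedding.injective _)]
    exact hF _
  · have : (F.map (Function.Embedding.subtype (· ∈ W))).neighborSet v = ∅ := by
      ext w
      simp only [mem_neighborSet, map_adj, Set.mem_empty_iff_false, iff_false]
      rintro ⟨a, b, -, rfl, -⟩
      exact hv a.2
    rw [this]; simp

theorem ncard_edgeSet_map {V' : Type*} (f : V ↪ V') (F : SimpleGraph V) :
    (F.map f).edgeSet.ncard = F.edgeSet.ncard := by
  rw [edgeSet_map, Set.ncard_image_of_injective _ f.sym2Map.injective]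

/-- Some optimum of `T` lives on `W`, so `T` and the reduced tree have the same maximal number of
edges. -/
theorem IsMaxLinear.map [Finite V] {T : SimpleGraph V} {W : Set V} (hW : IsLeafReduction T W)
    {F : SimpleGraph W} (hF : IsMaxLinear (T.induce W) F) :
    IsMaxLinear T (F.map (Function.Embedding.subtype (· ∈ W))) := by
  obtain ⟨H, hH, hHW⟩ := exists_isMaxLinear_forall_mem hW
  have hmap : (H.induce W).map (Function.Embedding.subtype (· ∈ W)) = H := by
    ext a b
    rw [map_adj]
    constructor
    · rintro ⟨a, b, h, rfl, rfl⟩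
      exact h
    · exact fun h => ⟨⟨a, hHW a b h⟩, ⟨b, hHW b a h.symm⟩, h, rfl, rfl⟩
  have hlin : IsLinear (H.induce W) := by
    intro v
    rw [← Set.ncard_image_of_injective _ Subtype.val_injective]
    refine le_trans (Set.ncard_le_ncard ?_) (hH.1.2 v)
    rintro _ ⟨w, hw, rfl⟩
    exact hw
  refine ⟨⟨?_, isLinear_map hF.1.2⟩, fun F' h1 h2 => (hH.2 F' h1 h2).trans ?_⟩
  · intro a b h
    obtain ⟨a, b, hab, rfl, rfl⟩ := (map_adj _ _ _ _).1 h
    exact hF.1.1 hab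
  · rw [ncard_edgeSet_map, ← hmap, ncard_edgeSet_map]
    exact hF.2 _ (comap_monotone _ hH.1.1) hlin

/-- The degrees of a maximum linear subgraph avoiding the removed leaves are determined by the
tree. -/
theorem ncard_neighborSet_eq_min [Fintype V] {T : SimpleGraph V} (hT : T.IsTree)
    (hiso : IsIsoUniqueZeroForcing T) {W : Set V} (hW : IsLeafReduction T W) {F : SimpleGraph V}
    (hF : IsMaxLinear T F) (hFW : ∀ x y, F.Adj x y → x ∈ W) {v : V} (hv : v ∈ W) :
    (F.neighborSet v).ncard = min 2 (T.neighborSet v).ncard := by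
  have hle : (F.neighborSet v).ncard ≤ (T.neighborSet v).ncard :=
    Set.ncard_le_ncard fun _ h => hF.1.1 h
  have h2 := hF.1.2 v
  by_cases h1 : (F.neighborSet v).ncard ≤ 1
  swap
  · omega
  have h3 := ncard_neighborSet_le_one_of_end hT hiso hF h1
  suffices h : (T.neighborSet v).ncard = 1 → (F.neighborSet v).ncard ≠ 0 by omega
  intro hT1 hF0
  obtain ⟨w, hw⟩ := Set.ncard_eq_one.1 hT1
  have hvw : T.Adj v w := by rw [← mem_neighborSet, hw]; rfl
  have hFv : F.neighborSet v = ∅ := (Set.ncard_eq_zero (Set.toFinite _)).1 hF0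
  have hFvw : ¬ F.Adj v w := fun h => by
    have : w ∈ F.neighborSet v := h
    rw [hFv] at this
    exact this
  have hleaf : ∀ x, T.Adj w x → (T.neighborSet x).ncard ≤ 1 → x ∈ leavesAt T w := by
    intro x hwx hx
    refine ⟨hwx, ?_⟩
    rw [← (Set.toFinite _).cast_ncard_eq]
    have : 0 < (T.neighborSet x).ncard := (Set.ncard_pos (Set.toFinite _)).2 ⟨w, hwx.symm⟩
    have h : (T.neighborSet x).ncard = 1 := by omega
    rw [h]; rfl
  -- Exchanging the edge `w x` for `v w` turns `x` into an end, hence a leaf. Together with `v`, the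
  -- two `F`-neighbours of `w` give three retained leaves at `w`, where only two may remain.
  have hleaf' : ∀ x, F.Adj w x → x ∈ leavesAt T w := by
    intro x hwx
    obtain ⟨hF', hx⟩ := hF.swap hvw hFvw h1 hwx
    exact hleaf x (hF.1.1 hwx) (ncard_neighborSet_le_one_of_end hT hiso hF' hx)
  have hsub : insert v (F.neighborSet w) ⊆ leavesAt T w ∩ W := by
    rintro x (rfl | hx)
    · exact ⟨hleaf x hvw.symm h3, hv⟩
    · exact ⟨hleaf' x hx, hFW x w (Adj.symm hx)⟩
  have hcard : (insert v (F.neighborSet w)).encard = 3 := by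
    have hvN : v ∉ F.neighborSet w := fun h => hFvw (Adj.symm h)
    rw [Set.encard_insert_of_notMem hvN,
      ← (Set.toFinite _).cast_ncard_eq, hF.ncard_eq_two hvw hFvw h1]
    norm_num
  have h4 := Set.encard_le_encard hsub
  have h5 := Set.encard_le_encard (hsub.trans Set.inter_subset_left)
  rw [hcard] at h4 h5
  rw [hW.2 w (lt_of_lt_of_le (by norm_num) h5)] at h4
  exact absurd h4 (by norm_num)

theorem isMaxLinear_induce_unique [Fintype V] {T : SimpleGraph V} (hT : T.IsTree)
    (hiso : IsIsoUniqueZeroForcing T) {W : Set V} (hW : IsLeafReduction T W)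
    {F₁ F₂ : SimpleGraph W} (h₁ : IsMaxLinear (T.induce W) F₁)
    (h₂ : IsMaxLinear (T.induce W) F₂) : F₁ = F₂ := by
  have hmem : ∀ (F : SimpleGraph W) (x y : V),
      (F.map (Function.Embedding.subtype (· ∈ W))).Adj x y → x ∈ W := by
    intro F x y h
    obtain ⟨a, b, -, rfl, -⟩ := (map_adj _ _ _ _).1 h
    exact a.2
  refine map_injective (Function.Embedding.subtype (· ∈ W)) (eq_of_ncard_neighborSet_eq hT
    (h₁.map hW).1.1 (h₂.map hW).1.1 fun v => ?_)
  by_cases hv : v ∈ W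
  · rw [ncard_neighborSet_eq_min hT hiso hW (h₁.map hW) (hmem F₁) hv,
      ncard_neighborSet_eq_min hT hiso hW (h₂.map hW) (hmem F₂) hv]
  · have : ∀ F : SimpleGraph W,
        (F.map (Function.Embedding.subtype (· ∈ W))).neighborSet v = ∅ := fun F =>
      Set.eq_empty_of_forall_notMem fun w h => hv (hmem F v w h)
    rw [this, this]

end IsoUniqueZF

theorem mainTheorem11 {V : Type*} [Finite V] (T : SimpleGraph V) (hT : T.IsTree)
    (hiso : IsoUniqueZF.IsIsoUniqueZeroForcing T)
    (W : Set V) (hW : IsoUniqueZF.IsLeafReduction T W) :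
    (T.induce W).IsTree ∧
      ∃! P : Set (T.induce W).Subgraph, IsoUniqueZF.IsMinPathCover (T.induce W) P := by
  cases nonempty_fintype V
  have hT' := IsoUniqueZF.isTree_induce hT hW
  obtain ⟨P, hP⟩ := IsoUniqueZF.exists_isMinPathCover hT'.isAcyclic
  refine ⟨hT', P, hP, fun Q hQ => ?_⟩
  have h := IsoUniqueZF.isMaxLinear_induce_unique hT hiso hW
    ((IsoUniqueZF.isMinPathCover_iff hT'.isAcyclic hP.1).1 hP)
    ((IsoUniqueZF.isMinPathCover_iff hT'.isAcyclic hQ.1).1 hQ)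
  exact (hQ.1.subset_of_coverGraph_eq hP.1 h.symm).antisymm (hP.1.subset_of_coverGraph_eq hQ.1 h)
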